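/- For every $\varepsilon>0$ there exists $n_0$ such that for all integers $n\ge \max(n_0,2)$ the following holds. Let $m=2^{n-1}$ and let $\boldsymbol d_1,\dots,\boldsymbol d_m\in\mathbb F_2^n$ be nonzero vectors (not necessarily distinct) with $\sum_{i=1}^m \boldsymbol d_i=\boldsymbol 0$. If some vector $\boldsymbol u$ satisfies $|\{i : \boldsymbol d_i=\boldsymbol u\}|\ge\left(\tfrac12+\varepsilon\right)m$, then $\mathbb F_2^n$ can be subdivided into disjoint pairs $\{\boldsymbol a_i,\boldsymbol b_i\}$ ($1\le i\le m$) such that $\boldsymbol a_i-\boldsymbol b_i=\boldsymbol d_i$ for every $i$. -/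

import Mathlib

/-- The pairs `{a i, b i}` form a subdivision of all of `G` into disjoint pairs such that
the `i`-th pair has difference `d i`. -/
structure IsDifferencePairing {G ι : Type*} [AddCommGroup G] (d a b : ι → G) : Prop where
  /-- The two elements of a pair are distinct. -/
  ne : ∀ i, a i ≠ b i
  /-- The `i`-th pair realises the `i`-th difference. -/
  sub_eq : ∀ i, a i - b i = d i
  /-- Different pairs are disjoint. -/
  disjoint : ∀ i j, i ≠ j → Disjoint ({a i, b i} : Set G) {a j, b j}
  /-- Every element of `G` lies in one of the pairs. -/
  cover : ⋃ i, ({a i, b i} : Set G) = Set.univ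

/-! Let `J` be the set of indices with `d i ≠ u`. It suffices to tile some `u`-invariant set with
the pairs of `J`: its complement is then a union of cosets of `{0, u}`, and each coset is a pair
with difference `u`.

Put `e i = d i + u`. A closed walk with steps `e i` and vertices distinct modulo `u` yields such a
tiling (`pairTiles_of_cycle`). The steps of `J` sum to zero, so they split into minimal zero-sum
sets. Each of these has at most `n + 1` elements and can be ordered into such a walk
(`IsCircuit.exists_order`). Placing these walks greedily handles only about `2 ^ n / n` indices
(`exists_pairTiles_of_small`).

For large `J`, two indices with equal differences form a four-point block that is easy to place, so
`d` may be taken injective on `J`. The majority hypothesis leaves more than half of the group free,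
and a Cauchy–Schwarz count then finds four-cycles in the free part as long as many indices remain
(`exists_fourCycle`). The few leftover indices are placed by the greedy lemma without regard to the
four-cycles. Each block that they hit is moved into a sparse reserve kept empty for this purpose,
which contains many translates of every four-point set (`RobustlyTiles.union_block`). -/

/-- The pairs `{a i, a i + d i}`, `i ∈ I`, can be chosen disjoint with union `X`. -/
def PairTiles {G ι : Type*} [AddCommGroup G] [DecidableEq G] (d : ι → G) (I : Finset ι)
    (X : Finset G) : Prop :=
  ∃ a : ι → G, (∀ i ∈ I, ∀ j ∈ I, i ≠ j →
      Disjoint ({a i, a i + d i} : Finset G) {a j, a j + d j}) ∧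
    I.biUnion (fun i => ({a i, a i + d i} : Finset G)) = X

/-! ### Tilings by pairs, invariance under `u`, and closed walks. -/

section PairTiles

variable {G ι : Type*} [AddCommGroup G] [DecidableEq G] {d : ι → G}

theorem PairTiles.card_eq {I : Finset ι} {X : Finset G} (h : PairTiles d I X)
    (hd : ∀ i ∈ I, d i ≠ 0) : X.card = 2 * I.card := by
  obtain ⟨a, ha, rfl⟩ := h
  rw [Finset.card_biUnion (fun i hi j hj hij => ha i hi j hj hij), Finset.sum_congr rfl
    (fun i hi => Finset.card_pair (a := a i) (b := a i + d i) (by simpa using (hd i hi)))]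
  simp [mul_comm]

theorem PairTiles.translate {I : Finset ι} {X : Finset G} (h : PairTiles d I X) (t : G) :
    PairTiles d I (X.image (· + t)) := by
  obtain ⟨a, ha, rfl⟩ := h
  have him : ∀ i, ({a i + t, a i + t + d i} : Finset G) =
      ({a i, a i + d i} : Finset G).image (· + t) := fun i => by
    simp [Finset.image_insert, add_right_comm]
  refine ⟨fun i => a i + t, ?_, ?_⟩
  · intro i hi j hj hij
    rw [him, him, Finset.disjoint_image (add_left_injective t)]
    exact ha i hi j hj hij
  · simp only [him, Finset.biUnion_image]

/-- Few points: some translate of `X` avoids `Y`. -/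
theorem exists_translate_disjoint [Fintype G] (X Y : Finset G)
    (h : X.card * Y.card < Fintype.card G) : ∃ t : G, Disjoint (X.image (· + t)) Y := by
  have hlt : ((X ×ˢ Y).image fun p => p.2 - p.1).card < (Finset.univ : Finset G).card := by
    refine Finset.card_image_le.trans_lt ?_
    rwa [Finset.card_product]
  obtain ⟨t, -, ht⟩ := Finset.exists_mem_notMem_of_card_lt_card hlt
  refine ⟨t, Finset.disjoint_left.2 fun z hz hzY => ht ?_⟩
  obtain ⟨x, hx, rfl⟩ := Finset.mem_image.1 hz
  exact Finset.mem_image.2 ⟨(x, x + t), Finset.mem_product.2 ⟨hx, hzY⟩, by simp⟩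

/-- A set closed under adding `u`. -/
def AddInvariant (u : G) (X : Finset G) : Prop := ∀ x ∈ X, x + u ∈ X

theorem AddInvariant.union {u : G} {X Y : Finset G} (hX : AddInvariant u X)
    (hY : AddInvariant u Y) : AddInvariant u (X ∪ Y) := fun x hx => by
  rcases Finset.mem_union.1 hx with hx | hx
  · exact Finset.mem_union_left _ (hX x hx)
  · exact Finset.mem_union_right _ (hY x hx)

theorem AddInvariant.translate {u : G} {X : Finset G} (hX : AddInvariant u X) (t : G) :
    AddInvariant u (X.image (· + t)) := fun x hx => by
  obtain ⟨y, hy, rfl⟩ := Finset.mem_image.1 hx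
  exact Finset.mem_image.2 ⟨y + u, hX y hy, add_right_comm _ _ _⟩

theorem AddInvariant.compl [Fintype G] (h2 : ∀ x : G, x + x = 0) {u : G} {X : Finset G}
    (hX : AddInvariant u X) : AddInvariant u Xᶜ := fun x hx => by
  rw [Finset.mem_compl] at hx ⊢
  intro h
  have := hX _ h
  rw [add_assoc, h2, add_zero] at this
  exact hx this

theorem addInvariant_biUnion_pair (h2 : ∀ x : G, x + x = 0) (u : G) (s : Finset ℕ)
    (y : ℕ → G) : AddInvariant u (s.biUnion fun i => {y i, y i + u}) := by
  intro z hz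
  simp only [Finset.mem_biUnion, Finset.mem_insert, Finset.mem_singleton] at hz ⊢
  obtain ⟨i, hi, rfl | rfl⟩ := hz
  · exact ⟨i, hi, Or.inr rfl⟩
  · exact ⟨i, hi, Or.inl (by rw [add_assoc, h2, add_zero])⟩

variable [DecidableEq ι]

theorem PairTiles.empty : PairTiles d ∅ ∅ := ⟨fun _ => 0, by simp, by simp⟩

theorem PairTiles.union {I J : Finset ι} {X Y : Finset G} (hI : PairTiles d I X)
    (hJ : PairTiles d J Y) (hIJ : Disjoint I J) (hXY : Disjoint X Y) :
    PairTiles d (I ∪ J) (X ∪ Y) := by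
  obtain ⟨a, ha, rfl⟩ := hI
  obtain ⟨b, hb, rfl⟩ := hJ
  have key : ∀ i ∈ J, i ∉ I := fun i hi hi' => (Finset.disjoint_left.1 hIJ hi' hi)
  have hcross : ∀ i ∈ I, ∀ j ∈ J,
      Disjoint ({a i, a i + d i} : Finset G) {b j, b j + d j} := fun i hi j hj =>
    hXY.mono (Finset.subset_biUnion_of_mem (fun i => ({a i, a i + d i} : Finset G)) hi)
      (Finset.subset_biUnion_of_mem (fun i => ({b i, b i + d i} : Finset G)) hj)
  refine ⟨fun i => if i ∈ I then a i else b i, ?_, ?_⟩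
  · intro i hi j hj hij
    rcases Finset.mem_union.1 hi with hi | hi <;> rcases Finset.mem_union.1 hj with hj | hj
    · simpa [hi, hj] using ha i hi j hj hij
    · simpa only [hi, key j hj, if_true, if_false] using hcross i hi j hj
    · simpa only [hj, key i hi, if_true, if_false] using (hcross j hj i hi).symm
    · simpa only [key i hi, key j hj, if_false] using hb i hi j hj hij
  · rw [Finset.union_biUnion]
    congr 1
    · exact Finset.biUnion_congr rfl fun i hi => by simp [hi]
    · exact Finset.biUnion_congr rfl fun i hi => by simp [key i hi]

theorem pairTiles_of_forall_eq (h2 : ∀ x : G, x + x = 0) {u : G} (hu : u ≠ 0) :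
    ∀ (K : Finset ι) (Y : Finset G), (∀ i ∈ K, d i = u) → AddInvariant u Y →
      Y.card = 2 * K.card → PairTiles d K Y := by
  intro K
  induction K using Finset.induction_on with
  | empty =>
    intro Y _ _ hc
    have : Y = ∅ := by simpa using hc
    subst this
    exact PairTiles.empty
  | insert k K hk ih =>
    intro Y hd hY hc
    rw [Finset.card_insert_of_notMem hk] at hc
    obtain ⟨y, hy⟩ : Y.Nonempty := Finset.card_pos.1 (by omega)
    have hne : y ≠ y + u := by simpa using hu
    have hsub : ({y, y + u} : Finset G) ⊆ Y := by
      intro z hz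
      simp only [Finset.mem_insert, Finset.mem_singleton] at hz
      rcases hz with rfl | rfl
      · exact hy
      · exact hY _ hy
    have hinv : AddInvariant u (Y \ {y, y + u}) := by
      intro z hz
      simp only [Finset.mem_sdiff, Finset.mem_insert, Finset.mem_singleton, not_or] at hz ⊢
      refine ⟨hY z hz.1, fun h => hz.2.2 ?_, fun h => hz.2.1 (add_right_cancel h)⟩
      rw [← h, add_assoc, h2, add_zero]
    have h1 := ih (Y \ {y, y + u}) (fun i hi => hd i (Finset.mem_insert_of_mem hi)) hinv (by
      rw [Finset.card_sdiff_of_subset hsub, Finset.card_pair hne]; omega)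
    have h0 : PairTiles d {k} {y, y + u} :=
      ⟨fun _ => y, by simp, by simp [hd k (Finset.mem_insert_self _ _)]⟩
    have := h0.union h1 (by simpa using hk) Finset.disjoint_sdiff
    rwa [Finset.union_sdiff_of_subset hsub] at this

/-- Closed walks with steps `d (f i) + u` that are injective modulo `u` give tilings. -/
theorem pairTiles_of_cycle (h2 : ∀ x : G, x + x = 0) {u : G} (hu : u ≠ 0) {ℓ : ℕ}
    {f : ℕ → ι} (hf : Set.InjOn f (Finset.range ℓ)) {y : ℕ → G}
    (hy : ∀ i < ℓ, y (i + 1) = y i + (d (f i) + u)) (hclose : y ℓ = y 0)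
    (hinj : ∀ i < ℓ, ∀ j < ℓ, i < j → y i ≠ y j ∧ y i ≠ y j + u) :
    PairTiles d ((Finset.range ℓ).image f)
      ((Finset.range ℓ).biUnion fun i => {y i, y i + u}) := by
  -- The pair of step `i` joins the vertex `y i` to the shifted vertex `y (i + 1) + u`. Going once
  -- around the cycle therefore uses every vertex and every shifted vertex exactly once.
  have hstep : ∀ i < ℓ, y i + d (f i) = y (i + 1) + u := fun i hi => by
    rw [hy i hi, ← add_assoc, add_assoc _ u u, h2, add_zero]
  have hwrap : ∀ i < ℓ, ∃ j < ℓ, y (i + 1) = y j ∧ (j = i + 1 ∨ (j = 0 ∧ i + 1 = ℓ)) := by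
    intro i hi
    rcases Nat.lt_or_ge (i + 1) ℓ with h | h
    · exact ⟨i + 1, h, rfl, Or.inl rfl⟩
    · have : i + 1 = ℓ := by omega
      exact ⟨0, by omega, by rw [this, hclose], Or.inr ⟨rfl, this⟩⟩
  have hsym : ∀ i < ℓ, ∀ j < ℓ, i ≠ j → y i ≠ y j ∧ y i ≠ y j + u := by
    intro i hi j hj hij
    rcases Nat.lt_or_gt_of_ne hij with h | h
    · exact hinj i hi j hj h
    · obtain ⟨h3, h4⟩ := hinj j hj i hi h
      refine ⟨h3.symm, fun h5 => h4 ?_⟩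
      rw [h5, add_assoc, h2, add_zero]
  have hne' : ∀ i < ℓ, ∀ j < ℓ, y i ≠ y j + u := by
    intro i hi j hj
    by_cases hij : i = j
    · subst hij; simpa using hu
    · exact (hsym i hi j hj hij).2
  have hg : ∀ i < ℓ, Function.invFunOn f (Finset.range ℓ : Set ℕ) (f i) = i := fun i hi =>
    hf.leftInvOn_invFunOn (by simpa using hi)
  refine ⟨fun k => y (Function.invFunOn f (Finset.range ℓ : Set ℕ) k), ?_, ?_⟩
  · intro p hp q hq hpq
    obtain ⟨i, hi, rfl⟩ := Finset.mem_image.1 hp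
    obtain ⟨j, hj, rfl⟩ := Finset.mem_image.1 hq
    rw [Finset.mem_range] at hi hj
    have hij : i ≠ j := fun h => hpq (by rw [h])
    obtain ⟨i', hi', hyi, hi''⟩ := hwrap i hi
    obtain ⟨j', hj', hyj, hj''⟩ := hwrap j hj
    have hij' : i' ≠ j' := by omega
    simp only [hg i hi, hg j hj, hstep i hi, hstep j hj, hyi, hyj]
    rw [Finset.disjoint_left]
    intro z hz hz'
    simp only [Finset.mem_insert, Finset.mem_singleton] at hz hz'
    rcases hz with rfl | rfl <;> rcases hz' with hz' | hz'
    · exact (hsym i hi j hj hij).1 hz'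
    · exact hne' i hi j' hj' hz'
    · exact hne' j hj i' hi' hz'.symm
    · exact (hsym i' hi' j' hj' hij').1 (add_right_cancel hz')
  · rw [Finset.image_biUnion]
    ext z
    simp only [Finset.mem_biUnion, Finset.mem_range, Finset.mem_insert, Finset.mem_singleton]
    constructor
    · rintro ⟨i, hi, hz⟩
      rw [hg i hi, hstep i hi] at hz
      obtain ⟨i', hi', hyi, -⟩ := hwrap i hi
      rcases hz with rfl | rfl
      · exact ⟨i, hi, Or.inl rfl⟩
      · exact ⟨i', hi', Or.inr (by rw [hyi])⟩
    · rintro ⟨i, hi, hz⟩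
      rcases hz with rfl | rfl
      · exact ⟨i, hi, Or.inl (by rw [hg i hi])⟩
      -- The shifted vertex `y i + u` belongs to the preceding step, which for `i = 0` is the last
      -- one.
      · rcases Nat.eq_zero_or_pos i with h0 | h0
        · subst h0
          refine ⟨ℓ - 1, by omega, Or.inr ?_⟩
          rw [hg _ (by omega), hstep _ (by omega), Nat.sub_add_cancel (by omega), hclose]
        · refine ⟨i - 1, by omega, Or.inr ?_⟩
          rw [hg _ (by omega), hstep _ (by omega), Nat.sub_add_cancel (by omega)]

end PairTiles

/-! ### Minimal zero-sum sets and the greedy tiling of few indices. -/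

section Circuits

variable {G ι : Type*} [AddCommGroup G] [DecidableEq ι]

theorem sum_symmDiff_of_add_self (h2 : ∀ x : G, x + x = 0) (e : ι → G) (A S : Finset ι) :
    ∑ i ∈ symmDiff A S, e i = ∑ i ∈ A, e i + ∑ i ∈ S, e i := by
  have hd : Disjoint (A \ S) (S \ A) := disjoint_sdiff_sdiff
  rw [symmDiff_def, Finset.sup_eq_union, Finset.sum_union hd,
    ← Finset.sum_inter_add_sum_sdiff A S e, ← Finset.sum_inter_add_sum_sdiff S A e,
    Finset.inter_comm S A]
  have := h2 (∑ i ∈ A ∩ S, e i)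
  rw [add_add_add_comm, this, zero_add]

/-- A minimal nonempty zero-sum set. -/
structure IsCircuit (e : ι → G) (C : Finset ι) : Prop where
  nonempty : C.Nonempty
  sum_eq : ∑ i ∈ C, e i = 0
  minimal : ∀ S ⊆ C, S.Nonempty → ∑ i ∈ S, e i = 0 → S = C

theorem exists_isCircuit (e : ι → G) : ∀ R : Finset ι, R.Nonempty → ∑ i ∈ R, e i = 0 →
    ∃ C ⊆ R, IsCircuit e C := by
  intro R
  induction R using Finset.strongInduction with
  | H R ih =>
    intro hR hs
    by_cases h : ∀ S ⊆ R, S.Nonempty → ∑ i ∈ S, e i = 0 → S = R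
    · exact ⟨R, subset_rfl, hR, hs, h⟩
    · push Not at h
      obtain ⟨S, hSR, hS, hS0, hne⟩ := h
      obtain ⟨C, hC, hC'⟩ := ih S (Finset.ssubset_iff_subset_ne.2 ⟨hSR, hne⟩) hS hS0
      exact ⟨C, hC.trans hSR, hC'⟩

/-- After one element is removed, all subset sums are distinct: two equal ones would make the
symmetric difference a proper nonempty zero-sum subset. In a group of order `2 ^ n` this bounds a
circuit by `n + 1` elements. -/
theorem IsCircuit.two_pow_le [Fintype G] (h2 : ∀ x : G, x + x = 0) {e : ι → G} {C : Finset ι}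
    (hC : IsCircuit e C) : 2 ^ (C.card - 1) ≤ Fintype.card G := by
  obtain ⟨c, hc⟩ := hC.nonempty
  rw [← Finset.card_erase_of_mem hc, ← Finset.card_powerset, ← Finset.card_univ]
  refine Finset.card_le_card_of_injOn (fun S => ∑ i ∈ S, e i) (fun _ _ => Finset.mem_univ _) ?_
  intro S hS T hT hST
  by_contra hne
  rw [Finset.mem_coe, Finset.mem_powerset] at hS hT
  have hsub : symmDiff S T ⊆ C.erase c := by
    intro x hx
    rcases Finset.mem_symmDiff.1 hx with h | h
    · exact hS h.1
    · exact hT h.1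
  have h0 : ∑ i ∈ symmDiff S T, e i = 0 := by
    rw [sum_symmDiff_of_add_self h2]
    simp only at hST
    rw [hST, h2]
  have hn : (symmDiff S T).Nonempty := by
    rw [Finset.nonempty_iff_ne_empty]
    intro h
    exact hne (symmDiff_eq_bot.1 h)
  have := hC.minimal _ (hsub.trans (Finset.erase_subset _ _)) hn h0
  rw [this] at hsub
  exact Finset.notMem_erase c C (hsub hc)

/-- The symmetric difference of two subsets with sum `u` has sum zero, so by minimality it is empty
or all of `C`. Hence an ordering has only two sets to avoid as intervals. -/
theorem IsCircuit.eq_or_eq_sdiff (h2 : ∀ x : G, x + x = 0) {e : ι → G} {C A S : Finset ι}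
    (hC : IsCircuit e C) {u : G} (hA : A ⊆ C) (hAu : ∑ i ∈ A, e i = u) (hS : S ⊆ C)
    (hSu : ∑ i ∈ S, e i = u) : S = A ∨ S = C \ A := by
  by_cases hn : (symmDiff A S).Nonempty
  · right
    have h0 : ∑ i ∈ symmDiff A S, e i = 0 := by
      rw [sum_symmDiff_of_add_self h2, hAu, hSu, h2]
    have hsub : symmDiff A S ⊆ C := by
      intro x hx
      rcases Finset.mem_symmDiff.1 hx with h | h
      · exact hA h.1
      · exact hS h.1
    have := hC.minimal _ hsub hn h0
    ext x
    rw [← this, Finset.mem_sdiff, Finset.mem_symmDiff]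
    by_cases hx : x ∈ A <;> by_cases hx' : x ∈ S <;> simp [hx, hx']
    have hxC := hS hx'
    rw [← this, Finset.mem_symmDiff] at hxC
    tauto
  · left
    rw [Finset.not_nonempty_iff_eq_empty] at hn
    exact (symmDiff_eq_bot.1 hn).symm

/-- A circuit can be ordered so that no proper interval sums to `u`. -/
theorem IsCircuit.exists_order (h2 : ∀ x : G, x + x = 0) {e : ι → G} {C : Finset ι}
    (hC : IsCircuit e C) {u : G} (hu : u ≠ 0) (he : ∀ i ∈ C, e i ≠ u) :
    ∃ f : ℕ → ι, Set.InjOn f (Finset.range C.card) ∧ (Finset.range C.card).image f = C ∧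
      ∀ i j, i < j → j < C.card →
        ∑ t ∈ Finset.Ico i j, e (f t) ≠ 0 ∧ ∑ t ∈ Finset.Ico i j, e (f t) ≠ u := by
  classical
  obtain ⟨c, hc⟩ := hC.nonempty
  have hlist : ∀ l : List ι, l.Nodup → l.toFinset = C →
      Set.InjOn (fun t => l.getD t c) (Finset.range C.card) ∧
      (Finset.range C.card).image (fun t => l.getD t c) = C := by
    intro l hl hlC
    have hlen : l.length = C.card := by rw [← hlC, List.toFinset_card_of_nodup hl]
    constructor
    · intro i hi j hj hij
      simp only [Finset.coe_range, Set.mem_Iio, ← hlen] at hi hj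
      simp only [List.getD_eq_getElem _ _ hi, List.getD_eq_getElem _ _ hj] at hij
      exact (hl.getElem_inj_iff).1 hij
    · ext x
      rw [Finset.mem_image, ← hlC, List.mem_toFinset, List.mem_iff_getElem]
      rw [hlC, ← hlen]
      constructor
      · rintro ⟨t, ht, rfl⟩
        rw [Finset.mem_range] at ht
        exact ⟨t, ht, by rw [List.getD_eq_getElem _ _ ht]⟩
      · rintro ⟨t, ht, rfl⟩
        exact ⟨t, Finset.mem_range.2 ht, by rw [List.getD_eq_getElem _ _ ht]⟩
  have hint : ∀ f : ℕ → ι, Set.InjOn f (Finset.range C.card) →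
      (Finset.range C.card).image f = C → ∀ i j, i < j → j < C.card →
      (Finset.Ico i j).image f ⊆ C ∧
      ∑ t ∈ Finset.Ico i j, e (f t) = ∑ k ∈ (Finset.Ico i j).image f, e k ∧
      (∀ t < C.card, f t ∈ (Finset.Ico i j).image f ↔ i ≤ t ∧ t < j) := by
    intro f hf hfC i j hij hj
    have hsub : Finset.Ico i j ⊆ Finset.range C.card := fun t ht => by
      rw [Finset.mem_Ico] at ht; rw [Finset.mem_range]; omega
    refine ⟨?_, ?_, ?_⟩
    · exact (Finset.image_subset_image hsub).trans hfC.subset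
    · rw [Finset.sum_image]
      exact fun x hx y hy h => hf (hsub hx) (hsub hy) h
    · intro t ht
      rw [Finset.mem_image]
      constructor
      · rintro ⟨s, hs, hst⟩
        have := hf (hsub hs) (by simpa using ht) hst
        subst this
        exact Finset.mem_Ico.1 hs
      · exact fun h => ⟨t, Finset.mem_Ico.2 h, rfl⟩
  have hne0 : ∀ f : ℕ → ι, Set.InjOn f (Finset.range C.card) →
      (Finset.range C.card).image f = C → ∀ i j, i < j → j < C.card →
      ∑ t ∈ Finset.Ico i j, e (f t) ≠ 0 := by
    intro f hf hfC i j hij hj h0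
    obtain ⟨h3, h4, h5⟩ := hint f hf hfC i j hij hj
    rw [h4] at h0
    have := hC.minimal _ h3 ⟨f i, Finset.mem_image_of_mem _ (Finset.left_mem_Ico.2 hij)⟩ h0
    have hjm : f j ∈ C := by
      rw [← hfC]; exact Finset.mem_image_of_mem _ (by simpa using hj)
    rw [← this, h5 j hj] at hjm
    omega
  by_cases hA : ∃ A ⊆ C, ∑ i ∈ A, e i = u
  · obtain ⟨A, hAC, hAu⟩ := hA
    have hBu : ∑ i ∈ C \ A, e i = u := by
      have := Finset.sum_sdiff (f := e) hAC
      rw [hAu, hC.sum_eq] at this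
      rw [← add_zero (∑ i ∈ C \ A, e i), ← h2 u, ← add_assoc, this, zero_add]
    -- Such a set is nonempty because `u ≠ 0`, and is no singleton because no step equals `u`.
    have hone : ∀ B ⊆ C, ∑ i ∈ B, e i = u → 1 < B.card := by
      intro B hB hBu
      rw [← not_le, Nat.le_one_iff_eq_zero_or_eq_one]
      rintro (h | h)
      · rw [Finset.card_eq_zero] at h
        subst h
        exact hu (by simpa using hBu.symm)
      · obtain ⟨x, rfl⟩ := Finset.card_eq_one.1 h
        rw [Finset.sum_singleton] at hBu
        exact he x (by simpa using hB) hBu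
    obtain ⟨a, ha, a', ha', haa⟩ := Finset.one_lt_card.1 (hone A hAC hAu)
    obtain ⟨b, hb, b', hb', hbb⟩ := Finset.one_lt_card.1 (hone _ Finset.sdiff_subset hBu)
    rw [Finset.mem_sdiff] at hb hb'
    have hab : a ≠ b := fun h => hb.2 (h ▸ ha)
    have hab' : a ≠ b' := fun h => hb'.2 (h ▸ ha)
    have ha'b : a' ≠ b := fun h => hb.2 (h ▸ ha')
    have ha'b' : a' ≠ b' := fun h => hb'.2 (h ▸ ha')
    set M := (C \ {a, b, a', b'}).toList with hM
    -- With `a, a'` in `A` and `b, b'` outside, an interval equal to `A` would have to contain `b`,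
    -- and one equal to `C \ A` would have to contain `a'`.
    set l := a :: b :: a' :: (M ++ [b']) with hl
    have hMm : ∀ x, x ∈ M ↔ x ∈ C ∧ x ≠ a ∧ x ≠ b ∧ x ≠ a' ∧ x ≠ b' := by
      intro x; simp [hM]
    have hnd : l.Nodup := by
      have hMn : M.Nodup := Finset.nodup_toList _
      simp only [hl, List.nodup_cons, List.mem_cons, List.mem_append, List.nodup_append, hMm]
      simp [hMn, hab, haa, hab', ha'b.symm, hbb, ha'b']
    have hlC : l.toFinset = C := by
      ext x
      simp only [hl, List.mem_toFinset, List.mem_cons, List.mem_append, hMm, List.not_mem_nil,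
        or_false]
      constructor
      · rintro (rfl | rfl | rfl | h | rfl)
        exacts [hAC ha, hb.1, hAC ha', h.1, hb'.1]
      · tauto
    obtain ⟨hinj, him⟩ := hlist l hnd hlC
    have hlen : C.card = M.length + 4 := by
      rw [← hlC, List.toFinset_card_of_nodup hnd]; simp [hl]
    refine ⟨_, hinj, him, fun i j hij hj => ⟨hne0 _ hinj him i j hij hj, fun hsu => ?_⟩⟩
    obtain ⟨h3, h4, h5⟩ := hint _ hinj him i j hij hj
    rw [h4] at hsu
    have h50 := h5 0 (by omega)
    have h51 := h5 1 (by omega)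
    have h52 := h5 2 (by omega)
    have h53 := h5 (M.length + 3) (by omega)
    have e0 : l.getD 0 c = a := by simp [hl]
    have e1 : l.getD 1 c = b := by simp [hl]
    have e2 : l.getD 2 c = a' := by simp [hl]
    have e3 : l.getD (M.length + 3) c = b' := by simp [hl]
    rw [e0] at h50
    rw [e1] at h51
    rw [e2] at h52
    rw [e3] at h53
    rcases hC.eq_or_eq_sdiff h2 hAC hAu h3 hsu with h | h
    · rw [h] at h50 h51 h52
      have := h50.1 ha
      have := h52.1 ha'
      exact hb.2 (h51.2 (by omega))
    · rw [h] at h51 h52 h53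
      have := h51.1 (Finset.mem_sdiff.2 hb)
      have := h53.1 (Finset.mem_sdiff.2 hb')
      exact (Finset.mem_sdiff.1 (h52.2 (by omega))).2 ha'
  · push Not at hA
    obtain ⟨hinj, him⟩ := hlist C.toList (Finset.nodup_toList _) (Finset.toList_toFinset _)
    refine ⟨_, hinj, him, fun i j hij hj => ⟨hne0 _ hinj him i j hij hj, ?_⟩⟩
    obtain ⟨h3, h4, -⟩ := hint _ hinj him i j hij hj
    rw [h4]
    exact hA _ h3

variable [DecidableEq G]

theorem IsCircuit.pairTiles (h2 : ∀ x : G, x + x = 0) {d : ι → G} {C : Finset ι} {u : G}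
    (hC : IsCircuit (fun i => d i + u) C) (hu : u ≠ 0) (hd : ∀ i ∈ C, d i ≠ 0) :
    ∃ X, PairTiles d C X ∧ AddInvariant u X := by
  obtain ⟨f, hf, hfC, hsum⟩ := hC.exists_order h2 hu (fun i hi => by simpa using hd i hi)
  set y : ℕ → G := fun i => ∑ t ∈ Finset.range i, (d (f t) + u) with hy
  have hdiff : ∀ i j, i < j → y j = y i + ∑ t ∈ Finset.Ico i j, (d (f t) + u) := fun i j hij =>
    (Finset.sum_range_add_sum_Ico _ hij.le).symm
  refine ⟨_, hfC ▸ pairTiles_of_cycle (d := d) (y := y) h2 hu hf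
    (fun i _ => Finset.sum_range_succ _ _) ?_ ?_, addInvariant_biUnion_pair h2 u _ _⟩
  · have : ∑ t ∈ Finset.range C.card, (d (f t) + u) =
        ∑ k ∈ (Finset.range C.card).image f, (d k + u) :=
      (Finset.sum_image (f := fun k => d k + u) hf).symm
    simp only [hy]
    rw [this, hfC, hC.sum_eq, Finset.sum_range_zero]
  · intro i _ j hj hij
    obtain ⟨h3, h4⟩ := hsum i j hij hj
    rw [hdiff i j hij]
    constructor
    · simpa using h3
    · intro h
      rw [add_assoc, left_eq_add] at h
      apply h4
      rw [← add_zero (Finset.sum _ _), ← h2 u, ← add_assoc, h, zero_add]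

/-- Circuits are split off one at a time. Each covers at most `2 * (n + 1)` points and the rest at
most `2 * R.card`, so the size bound leaves a translate that avoids what is already placed. -/
theorem exists_pairTiles_of_small [Fintype G] (h2 : ∀ x : G, x + x = 0) {d : ι → G} {u : G}
    (hu : u ≠ 0) {n : ℕ} (hn : Fintype.card G = 2 ^ n) :
    ∀ R : Finset ι, (∀ i ∈ R, d i ≠ 0) → ∑ i ∈ R, (d i + u) = 0 →
      4 * (n + 1) * R.card < 2 ^ n → ∃ X, PairTiles d R X ∧ AddInvariant u X := by
  intro R
  induction R using Finset.strongInduction with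
  | H R ih =>
    intro hd hs hsmall
    rcases R.eq_empty_or_nonempty with rfl | hR
    · exact ⟨∅, PairTiles.empty, fun x hx => by simp at hx⟩
    obtain ⟨C, hCR, hC⟩ := exists_isCircuit _ R hR hs
    obtain ⟨X, hX, hXu⟩ := hC.pairTiles h2 hu fun i hi => hd i (hCR hi)
    have hcard : C.card ≤ n + 1 := by
      have := hC.two_pow_le h2
      rw [hn, Nat.pow_le_pow_iff_right (by norm_num)] at this
      omega
    have hle : (R \ C).card ≤ R.card := Finset.card_le_card Finset.sdiff_subset
    obtain ⟨Y, hY, hYu⟩ := ih (R \ C) (Finset.sdiff_ssubset hCR hC.nonempty)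
      (fun i hi => hd i (Finset.sdiff_subset hi))
      (by
        have := Finset.sum_sdiff (f := fun i => d i + u) hCR
        rwa [hC.sum_eq, hs, add_zero] at this)
      (lt_of_le_of_lt (Nat.mul_le_mul_left _ hle) hsmall)
    obtain ⟨t, ht⟩ := exists_translate_disjoint X Y (by
      rw [hX.card_eq fun i hi => hd i (hCR hi),
        hY.card_eq fun i hi => hd i (Finset.sdiff_subset hi), hn]
      calc 2 * C.card * (2 * (R \ C).card) ≤ 2 * (n + 1) * (2 * R.card) := by gcongr
        _ = 4 * (n + 1) * R.card := by ring
        _ < 2 ^ n := hsmall)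
    have := (hX.translate t).union hY Finset.disjoint_sdiff ht
    rw [Finset.union_sdiff_of_subset hCR] at this
    exact ⟨_, this, (hXu.translate t).union hYu⟩

end Circuits

/-! ### Four-cycles in a set of density above one half. -/

section FourCycles

variable {G : Type*} [AddCommGroup G] [DecidableEq G] [Fintype G]

/-- The set of pairs of steps from `S` that lead from `y` into `F` and do not sum to `0` or `u`. -/
def cherries (u : G) (F S : Finset G) : Finset (G × G × G) :=
  {p ∈ F ×ˢ (S ×ˢ S) | p.1 + p.2.1 ∈ F ∧ p.1 + p.2.2 ∈ F ∧ p.2.1 + p.2.2 ≠ 0 ∧ p.2.1 + p.2.2 ≠ u}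

/-- Double counting: for each `s`, inclusion–exclusion shows that `F` and `F - s` meet in at least
`2 * F.card - Fintype.card G` points. -/
theorem sum_card_filter_add_mem (F S : Finset G) :
    S.card * (2 * F.card) ≤
      ∑ y ∈ F, {s ∈ S | y + s ∈ F}.card + S.card * Fintype.card G := by
  have h1 : ∑ y ∈ F, {s ∈ S | y + s ∈ F}.card = ∑ s ∈ S, {y ∈ F | y + s ∈ F}.card := by
    simp only [Finset.card_filter]
    exact Finset.sum_comm
  rw [h1, ← smul_eq_mul, ← smul_eq_mul (S.card), ← Finset.sum_const, ← Finset.sum_const,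
    ← Finset.sum_add_distrib]
  refine Finset.sum_le_sum fun s _ => ?_
  have h2 : (F ∪ F.image (fun y => y - s)).card + (F ∩ F.image (fun y => y - s)).card =
      2 * F.card := by
    rw [Finset.card_union_add_card_inter, Finset.card_image_of_injective F (sub_left_injective (b := s))]
    ring
  have h3 : F ∩ F.image (fun y => y - s) = {y ∈ F | y + s ∈ F} := by
    ext y
    simp [Finset.mem_inter, sub_eq_iff_eq_add]
  rw [h3] at h2
  have := Finset.card_le_univ (F ∪ F.image (fun y => y - s))
  omega

/-- At each centre the excluded pairs of steps are `(s, s)` and `(s, s + u)`, at most `2 * S.card`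
in number. -/
theorem sum_sq_le_card_cherries (h2 : ∀ x : G, x + x = 0) (u : G) (F S : Finset G) :
    ∑ y ∈ F, {s ∈ S | y + s ∈ F}.card ^ 2 ≤
      (cherries u F S).card + 2 * S.card * Fintype.card G := by
  have h1 : (cherries u F S).card = ∑ y ∈ F, {q ∈ S ×ˢ S | y + q.1 ∈ F ∧ y + q.2 ∈ F ∧
      q.1 + q.2 ≠ 0 ∧ q.1 + q.2 ≠ u}.card := by
    simp only [cherries, Finset.card_filter, Finset.sum_product (s := F)]
  have h3 : 2 * S.card * Fintype.card G ≥ ∑ y ∈ F, 2 * S.card := by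
    rw [Finset.sum_const, smul_eq_mul, mul_comm (2 * S.card)]
    exact Nat.mul_le_mul_right _ (Finset.card_le_univ F)
  refine le_trans ?_ (Nat.add_le_add_left h3 _)
  rw [h1, ← Finset.sum_add_distrib]
  refine Finset.sum_le_sum fun y _ => ?_
  have h4 : {s ∈ S | y + s ∈ F} ×ˢ {s ∈ S | y + s ∈ F} ⊆
      {q ∈ S ×ˢ S | y + q.1 ∈ F ∧ y + q.2 ∈ F ∧ q.1 + q.2 ≠ 0 ∧ q.1 + q.2 ≠ u} ∪
      (S.image (fun s => (s, s)) ∪ S.image (fun s => (s, s + u))) := by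
    rintro ⟨a, b⟩ hab
    simp only [Finset.mem_product, Finset.mem_filter] at hab
    simp only [Finset.mem_union, Finset.mem_filter, Finset.mem_product, Finset.mem_image,
      Prod.mk.injEq]
    by_cases h0 : a + b = 0
    · refine Or.inr (Or.inl ⟨a, hab.1.1, rfl, ?_⟩)
      rw [← add_zero a, ← h2 b, ← add_assoc, h0, zero_add]
    by_cases hu : a + b = u
    · refine Or.inr (Or.inr ⟨a, hab.1.1, rfl, ?_⟩)
      rw [← hu, ← add_assoc, h2, zero_add]
    exact Or.inl ⟨⟨hab.1.1, hab.2.1⟩, hab.1.2, hab.2.2, h0, hu⟩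
  have h5 := (Finset.card_le_card h4).trans (Finset.card_union_le _ _)
  rw [Finset.card_product, ← sq] at h5
  refine h5.trans (Nat.add_le_add_left ((Finset.card_union_le _ _).trans ?_) _)
  rw [two_mul]
  exact Nat.add_le_add Finset.card_image_le Finset.card_image_le

/-- By Cauchy–Schwarz the squared degrees sum to more than `6 * N ^ 2`, where `N` is the order of
the group. Degenerate cherries cost at most `2 * N ^ 2`. The remaining `4 * N ^ 2` gives more than
four cherries on some pair of endpoints. -/
theorem lt_card_cherries (h2 : ∀ x : G, x + x = 0) (u : G) (F S : Finset G) {κ : ℝ} (hκ : 0 < κ)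
    (hF : (1 + κ) * Fintype.card G ≤ 2 * F.card)
    (hS : 6 * (Fintype.card G : ℝ) < κ ^ 2 * S.card ^ 2) :
    (Fintype.card G * Fintype.card G) * 4 < (cherries u F S).card := by
  set N : ℝ := (Fintype.card G : ℝ) with hN
  have hNpos : 0 < N := by
    rw [hN]; exact_mod_cast Fintype.card_pos
  set D : ℝ := ∑ y ∈ F, ({s ∈ S | y + s ∈ F}.card : ℝ) with hD
  set Q : ℝ := ∑ y ∈ F, ({s ∈ S | y + s ∈ F}.card : ℝ) ^ 2 with hQ
  have h1 : (S.card : ℝ) * (2 * F.card) ≤ D + S.card * N := by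
    have := sum_card_filter_add_mem F S
    rw [hD, hN]
    exact_mod_cast this
  have h3 : Q ≤ (cherries u F S).card + 2 * S.card * N := by
    have := sum_sq_le_card_cherries h2 u F S
    rw [hQ, hN]
    exact_mod_cast this
  have h4 : D ^ 2 ≤ F.card * Q := sq_sum_le_card_mul_sum_sq
  have hFN : (F.card : ℝ) ≤ N := by
    rw [hN]; exact_mod_cast Finset.card_le_univ F
  have hSN : (S.card : ℝ) ≤ N := by
    rw [hN]; exact_mod_cast Finset.card_le_univ S
  have hQ0 : 0 ≤ Q := Finset.sum_nonneg fun _ _ => sq_nonneg _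
  have hr0 : (0 : ℝ) ≤ S.card := Nat.cast_nonneg _
  have h5 : κ * S.card * N ≤ D := by
    have := mul_le_mul_of_nonneg_left hF hr0
    linarith [show (S.card : ℝ) * ((1 + κ) * N) = κ * S.card * N + S.card * N by ring]
  have h6 : (κ * S.card * N) ^ 2 ≤ N * Q :=
    (pow_le_pow_left₀ (mul_nonneg (mul_nonneg hκ.le hr0) hNpos.le) h5 2).trans
      (h4.trans (mul_le_mul_of_nonneg_right hFN hQ0))
  have h7 : κ ^ 2 * S.card ^ 2 * N ≤ Q := by
    refine le_of_mul_le_mul_left ?_ hNpos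
    rwa [show N * (κ ^ 2 * S.card ^ 2 * N) = (κ * S.card * N) ^ 2 by ring]
  have h8 : 6 * N * N < Q := lt_of_lt_of_le (mul_lt_mul_of_pos_right hS hNpos) h7
  have h9 : (S.card : ℝ) * N ≤ N * N := mul_le_mul_of_nonneg_right hSN hNpos.le
  have h10 : N * N * 4 < (cherries u F S).card := by linarith
  have h11 : ((Fintype.card G * Fintype.card G * 4 : ℕ) : ℝ) < (cherries u F S).card := by
    push_cast
    exact h10
  exact Nat.cast_lt.1 h11

/-- A large enough set of steps contains a nondegenerate four-cycle inside `F`. -/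
theorem exists_fourCycle (h2 : ∀ x : G, x + x = 0) (u : G) (F S : Finset G) {κ : ℝ} (hκ : 0 < κ)
    (hF : (1 + κ) * Fintype.card G ≤ 2 * F.card)
    (hS : 6 * (Fintype.card G : ℝ) < κ ^ 2 * S.card ^ 2) :
    ∃ x ∈ F, ∃ e ∈ S, ∃ f ∈ S, ∃ g ∈ S, ∃ h ∈ S, x + e ∈ F ∧ x + e + f ∈ F ∧ x + h ∈ F ∧
      e + f + g + h = 0 ∧ e + f ≠ 0 ∧ e + f ≠ u ∧ f + g ≠ 0 ∧ f + g ≠ u ∧ e + g ≠ 0 := by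
  have hlt := lt_card_cherries h2 u F S hκ hF hS
  obtain ⟨p, -, hp⟩ := Finset.exists_lt_card_fiber_of_mul_lt_card_of_maps_to
    (s := cherries u F S) (t := (Finset.univ : Finset (G × G)))
    (f := fun p => (p.1 + p.2.1, p.1 + p.2.2)) (fun _ _ => Finset.mem_univ _)
    (n := 4) (by rwa [Finset.card_univ, Fintype.card_prod])
  set T := {q ∈ cherries u F S | (q.1 + q.2.1, q.1 + q.2.2) = p} with hT
  have hinj : Set.InjOn (fun q : G × G × G => q.2.1) T := by
    rintro ⟨y, a, b⟩ hq ⟨y', a', b'⟩ hq' heq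
    simp only [hT, Finset.coe_filter, Set.mem_ofPred_eq] at hq hq'
    simp only at heq
    subst heq
    have hh := hq.2.trans hq'.2.symm
    simp only [Prod.mk.injEq] at hh
    obtain ⟨h3, h4⟩ := hh
    have := add_right_cancel h3
    subst this
    have := add_left_cancel h4
    subst this
    rfl
  obtain ⟨⟨y, e, f⟩, hq⟩ : T.Nonempty := Finset.card_pos.1 (by omega)
  -- A cherry with given endpoints is determined by its first step, so more than four cherries leave
  -- one whose first step avoids these values.
  have hcard : ({e, f, e + u, f + u} : Finset G).card < (T.image fun q => q.2.1).card := by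
    rw [Finset.card_image_of_injOn hinj]
    exact lt_of_le_of_lt Finset.card_le_four hp
  obtain ⟨e', he', hne⟩ := Finset.exists_mem_notMem_of_card_lt_card hcard
  obtain ⟨⟨y', e'', f'⟩, hq', rfl⟩ := Finset.mem_image.1 he'
  simp only [hT, Finset.mem_filter, cherries, Finset.mem_product] at hq hq'
  obtain ⟨⟨⟨hy, he, hf⟩, hye, hyf, hs0, hsu⟩, hp1⟩ := hq
  obtain ⟨⟨⟨hy', he', hf'⟩, hye', hyf', hs0', hsu'⟩, hp2⟩ := hq'
  have hh := hp2.trans hp1.symm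
  simp only [Prod.mk.injEq] at hh
  obtain ⟨hx, hz⟩ := hh
  simp only [Finset.mem_insert, Finset.mem_singleton, not_or] at hne
  obtain ⟨hne1, hne2, hne3, hne4⟩ := hne
  have hcancel : ∀ a b : G, a + b + b = a := fun a b => by rw [add_assoc, h2, add_zero]
  have heq : ∀ a b c : G, a + b = c → a = c + b := fun a b c h => by rw [← h, hcancel]
  have hsum : e + f = e'' + f' := by
    have h3 : (y' + e'') + (y' + f') = (y + e) + (y + f) := by rw [hx, hz]
    rw [add_add_add_comm, h2, zero_add, add_add_add_comm, h2, zero_add] at h3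
    exact h3.symm
  have hfg : f + f' = e + e'' := by
    have h3 : (e + f) + (f + e'') = (e'' + f') + (e'' + f) := by rw [hsum, add_comm f e'']
    rw [← add_assoc, hcancel, add_add_add_comm, h2, zero_add] at h3
    rw [h3, add_comm]
  have heg : e + f' = f + e'' := by
    have h3 : (e + f) + (f + f') = (e'' + f') + (f' + f) := by rw [hsum, add_comm f f']
    rw [← add_assoc, hcancel, ← add_assoc, hcancel] at h3
    rw [h3, add_comm]
  -- The cycle starts at the common endpoint `y + e` and runs through the centre `y`, the other
  -- endpoint `y + f` and the second centre `y'`.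
  refine ⟨y + e, hye, e, he, f, hf, f', hf', e'', he', ?_, ?_, ?_, ?_, hs0, hsu, ?_, ?_, ?_⟩
  · rwa [hcancel]
  · rwa [hcancel]
  · rwa [← hx, hcancel]
  · rw [hsum, add_assoc, add_comm f' e'', h2]
  · rw [hfg]; intro h; exact hne1 (by rw [add_comm] at h; simpa using heq _ _ _ h)
  · rw [hfg]; intro h; exact hne3 (by rw [add_comm] at h; rw [heq _ _ _ h, add_comm])
  · rw [heg]; intro h; exact hne2 (by rw [add_comm] at h; simpa using heq _ _ _ h)

end FourCycles

/-! ### Four-point blocks and the reserve. -/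

theorem card_fiber_mul_card {G H : Type*} [AddCommGroup G] [Fintype G] [AddCommGroup H] [Fintype H] [DecidableEq H]
    (φ : G →+ H) (hφ : Function.Surjective φ) (v : H) :
    ({x | φ x = v} : Finset G).card * Fintype.card H = Fintype.card G := by
  have h1 := Finset.card_eq_sum_card_fiberwise (f := φ) (s := (Finset.univ : Finset G))
    (t := (Finset.univ : Finset H)) (fun _ _ => Finset.mem_coe.2 (Finset.mem_univ _))
  rw [Finset.card_univ] at h1
  rw [h1, Finset.sum_congr rfl fun w _ => AddMonoidHom.card_fiber_eq_of_mem_range φ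
    (Set.mem_range.2 (hφ w)) (Set.mem_range.2 (hφ v))]
  simp [mul_comm]

/-- A set containing many translates of every four-point set. -/
def reserve {G K : Type*} [AddCommGroup G] [AddCommGroup K] [DecidableEq K] [Fintype G]
    (φ : G →+ (Fin 4 → K)) :
    Finset G := {x | ∃ b, φ x b = 0}

theorem addInvariant_reserve {G K : Type*} [AddCommGroup G] [AddCommGroup K] [DecidableEq K]
    [Fintype G] {φ : G →+ (Fin 4 → K)} {u : G} (hu : φ u = 0) : AddInvariant u (reserve φ) := by
  intro x hx
  simp only [reserve, Finset.mem_filter, Finset.mem_univ, true_and, map_add, hu, add_zero] at hx ⊢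
  exact hx

section Blocks

variable {G ι : Type*} [AddCommGroup G] [DecidableEq G]

/-- The translate by `y` of four points together with their translates by `u`. -/
def blockSet (u : G) (P : Fin 4 → G) (y : G) : Finset G :=
  Finset.univ.biUnion fun b => {y + P b, y + P b + u}

theorem mem_blockSet {u : G} {P : Fin 4 → G} {y z : G} :
    z ∈ blockSet u P y ↔ ∃ b, z = y + P b ∨ z = y + P b + u := by
  simp [blockSet]

theorem addInvariant_blockSet (h2 : ∀ x : G, x + x = 0) (u : G) (P : Fin 4 → G) (y : G) :
    AddInvariant u (blockSet u P y) := by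
  intro z hz
  rw [mem_blockSet] at hz ⊢
  obtain ⟨b, rfl | rfl⟩ := hz
  · exact ⟨b, Or.inr rfl⟩
  · exact ⟨b, Or.inl (by rw [add_assoc, h2, add_zero])⟩

theorem blockSet_subset {u : G} {X : Finset G} (hX : AddInvariant u X) {P : Fin 4 → G} {y : G}
    (h : ∀ b, y + P b ∈ X) : blockSet u P y ⊆ X := by
  intro z hz
  rw [mem_blockSet] at hz
  obtain ⟨b, rfl | rfl⟩ := hz
  · exact h b
  · exact hX _ (h b)

/-- Four indices whose pairs tile all translates of a fixed block. -/
structure IsFourBlock (d : ι → G) (u : G) (I : Finset ι) (P : Fin 4 → G) : Prop where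
  card_eq : I.card = 4
  pairTiles : ∀ y, PairTiles d I (blockSet u P y)

theorem IsFourBlock.card_blockSet {d : ι → G} {u : G} {I : Finset ι} {P : Fin 4 → G}
    (h : IsFourBlock d u I P) (hd : ∀ i ∈ I, d i ≠ 0) (y : G) : (blockSet u P y).card = 8 := by
  rw [(h.pairTiles y).card_eq hd, h.card_eq]

/-- The walk is `0, e, e + f, h`, closed by the step `h`. The differences of its vertices are `e`,
`f`, `g`, `h`, `e + f` and `f + g`, which are exactly the elements required to differ from `0` and
`u`. -/
theorem isFourBlock [DecidableEq ι] (h2 : ∀ x : G, x + x = 0) {u : G} (hu : u ≠ 0) {d : ι → G}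
    {i₀ i₁ i₂ i₃ : ι} (h01 : i₀ ≠ i₁) (h02 : i₀ ≠ i₂) (h03 : i₀ ≠ i₃) (h12 : i₁ ≠ i₂)
    (h13 : i₁ ≠ i₃) (h23 : i₂ ≠ i₃) {e f g h : G} (he : d i₀ + u = e) (hf : d i₁ + u = f)
    (hg : d i₂ + u = g) (hh : d i₃ + u = h) (hsum : e + f + g + h = 0)
    (he' : e ≠ 0 ∧ e ≠ u) (hf' : f ≠ 0 ∧ f ≠ u) (hg' : g ≠ 0 ∧ g ≠ u) (hh' : h ≠ 0 ∧ h ≠ u)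
    (hef : e + f ≠ 0 ∧ e + f ≠ u) (hfg : f + g ≠ 0 ∧ f + g ≠ u) :
    IsFourBlock d u {i₀, i₁, i₂, i₃} ![0, e, e + f, h] := by
  have hcancel : ∀ a b : G, a + b + b = a := fun a b => by rw [add_assoc, h2, add_zero]
  have hh3 : e + f + g = h := by
    have := hcancel (e + f + g) h
    rw [hsum, zero_add] at this
    exact this.symm
  refine ⟨by simp [*], fun y => ?_⟩
  set F : ℕ → ι := fun t => [i₀, i₁, i₂, i₃].getD t i₀ with hF
  have key := pairTiles_of_cycle (d := d) (u := u) (ℓ := 4) (f := F)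
    (y := fun t => y + [0, e, e + f, h].getD t 0) h2 hu ?_ ?_ ?_ ?_
  · convert key using 1
    · ext x
      simp [hF, Finset.range_add_one]
      tauto
    · ext x
      simp [blockSet, Fin.exists_fin_succ, Finset.range_add_one]
      tauto
  · have hnd : [i₀, i₁, i₂, i₃].Nodup := by simp [*]
    intro i hi j hj hij
    simp only [Finset.coe_range, Set.mem_Iio] at hi hj
    simp only [hF, List.getD_eq_getElem [i₀, i₁, i₂, i₃] _ hi,
      List.getD_eq_getElem [i₀, i₁, i₂, i₃] _ hj] at hij
    exact (hnd.getElem_inj_iff).1 hij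
  · intro i hi
    interval_cases i
    · simp [hF, he]
    · simp [hF, hf, add_assoc]
    · simp [hF, hg, ← hh3, add_assoc]
    · simp [hF, hh, add_assoc, h2]
  · simp
  · have red : ∀ a b s : G, a + b = s → s ≠ 0 ∧ s ≠ u → y + a ≠ y + b ∧ y + a ≠ y + b + u := by
      rintro a b _ rfl ⟨h3, h4⟩
      refine ⟨fun h5 => h3 ?_, fun h5 => h4 ?_⟩
      · rw [add_left_cancel h5, h2]
      · rw [add_assoc] at h5
        rw [add_left_cancel h5, add_comm b u, hcancel]
    intro i hi j hj hij
    interval_cases j <;> interval_cases i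
    · exact red _ _ _ (by simp) he'
    · exact red _ _ _ (by simp) hef
    · exact red _ _ f (by simp [← add_assoc, h2]) hf'
    · exact red _ _ _ (by simp) hh'
    · exact red _ _ (f + g) (by simp [← hh3, ← add_assoc, h2]) hfg
    · refine red _ _ g ?_ hg'
      simp only [List.getD_cons_succ, List.getD_cons_zero, ← hh3]
      rw [← add_assoc, h2, zero_add]

section Reserve

variable {K : Type*} [AddCommGroup K] [Fintype K] [DecidableEq K] [Fintype G]
  {φ : G →+ (Fin 4 → K)}

theorem card_reserve_mul_le (hφ : Function.Surjective φ) :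
    (reserve φ).card * Fintype.card K ≤ 4 * Fintype.card G := by
  have h1 : reserve φ ⊆ Finset.univ.biUnion fun b : Fin 4 =>
      ({x | ((Pi.evalAddMonoidHom (fun _ => K) b).comp φ) x = 0} : Finset G) := by
    intro x hx
    simpa [reserve] using hx
  have h3 := (Finset.card_le_card h1).trans Finset.card_biUnion_le
  refine (Nat.mul_le_mul_right _ h3).trans ?_
  rw [Finset.sum_mul, Finset.sum_congr rfl fun b _ => card_fiber_mul_card
    ((Pi.evalAddMonoidHom (fun _ => K) b).comp φ) (by
      intro k
      obtain ⟨x, hx⟩ := hφ (fun _ => k)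
      exact ⟨x, by simp [hx]⟩) 0]
  simp

/-- The four components of `φ` serve the four points: `y` is chosen so that component `b` of `φ (y +
P b)` vanishes for every `b`. These `y` form a fibre of `φ`, of size `|G| / |K| ^ 4`, and each point
of `B` excludes at most eight of them. -/
theorem exists_blockSet_subset_reserve (hφ : Function.Surjective φ) {u : G} (hu : φ u = 0)
    (P : Fin 4 → G) (B : Finset G) (hB : 8 * B.card * Fintype.card K ^ 4 < Fintype.card G) :
    ∃ y, blockSet u P y ⊆ reserve φ ∧ Disjoint (blockSet u P y) B := by
  set T : Finset G := {y | φ y = fun b => -φ (P b) b} with hT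
  set D : Finset G := Finset.univ.biUnion fun b : Fin 4 =>
    B.image (fun x => x - P b) ∪ B.image (fun x => x - u - P b) with hD
  have hDcard : D.card ≤ 8 * B.card := by
    refine Finset.card_biUnion_le.trans ?_
    refine (Finset.sum_le_card_nsmul _ _ (2 * B.card) fun b _ => ?_).trans ?_
    · refine (Finset.card_union_le _ _).trans ?_
      rw [two_mul]
      exact Nat.add_le_add Finset.card_image_le Finset.card_image_le
    · simp; omega
  have hTcard := card_fiber_mul_card φ hφ (fun b => -φ (P b) b)
  rw [Fintype.card_fun, Fintype.card_fin] at hTcard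
  have hlt : D.card < T.card := by
    refine lt_of_le_of_lt hDcard ?_
    rw [← hTcard] at hB
    exact lt_of_mul_lt_mul_right hB (Nat.zero_le _)
  obtain ⟨y, hyT, hyD⟩ := Finset.exists_mem_notMem_of_card_lt_card hlt
  refine ⟨y, blockSet_subset (addInvariant_reserve hu) fun b => ?_, ?_⟩
  · simp only [hT, Finset.mem_filter, Finset.mem_univ, true_and] at hyT
    simp only [reserve, Finset.mem_filter, Finset.mem_univ, true_and]
    exact ⟨b, by rw [map_add, hyT]; simp⟩
  · rw [Finset.disjoint_left]
    intro z hz hzB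
    apply hyD
    rw [mem_blockSet] at hz
    obtain ⟨b, hz⟩ := hz
    simp only [hD, Finset.mem_biUnion, Finset.mem_univ, true_and, Finset.mem_union,
      Finset.mem_image]
    rcases hz with rfl | rfl
    · exact ⟨b, Or.inl ⟨_, hzB, by simp⟩⟩
    · exact ⟨b, Or.inr ⟨_, hzB, by simp⟩⟩

end Reserve

/-! ### Robust tilings. -/

/-- `A` is tiled by a set that coincides with `X₀` up to moving few blocks into `W`,
and can be moved off any set of at most `z` points. -/
structure RobustlyTiles (d : ι → G) (u : G) (W : Finset G) (z : ℕ) (A : Finset ι)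
    (X₀ : Finset G) : Prop where
  disjoint : Disjoint X₀ W
  card_eq : X₀.card = 2 * A.card
  addInvariant : AddInvariant u X₀
  exists_pairTiles : ∀ Z : Finset G, Z.card ≤ z → ∃ X, PairTiles d A X ∧ AddInvariant u X ∧
    Disjoint X Z ∧ X ⊆ X₀ ∪ W ∧ (X ∩ W).card ≤ 8 * (Z ∩ X₀).card

theorem RobustlyTiles.empty [DecidableEq ι] (d : ι → G) (u : G) (W : Finset G) (z : ℕ) :
    RobustlyTiles d u W z ∅ ∅ :=
  ⟨by simp, by simp, fun x hx => by simp at hx, fun Z _ =>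
    ⟨∅, PairTiles.empty, fun x hx => by simp at hx, by simp, by simp, by simp⟩⟩

/-- The new block stays in place if it misses `Z`; otherwise it moves into the reserve. A moved
block adds eight points there and is paid for by a point of `Z` in its original position, which
preserves the bound on `X ∩ W`. -/
theorem RobustlyTiles.union_block [DecidableEq ι] [Fintype G] {K : Type*} [AddCommGroup K]
    [Fintype K] [DecidableEq K] (h2 : ∀ x : G, x + x = 0) {φ : G →+ (Fin 4 → K)}
    (hφ : Function.Surjective φ)
    {d : ι → G} {u : G} (hu : φ u = 0) {z : ℕ}
    (hz : 72 * z * Fintype.card K ^ 4 < Fintype.card G) {A : Finset ι} {X₀ : Finset G}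
    (hA : RobustlyTiles d u (reserve φ) z A X₀) {I : Finset ι} {P : Fin 4 → G}
    (hI : IsFourBlock d u I P) (hd : ∀ i ∈ I, d i ≠ 0) (hAI : Disjoint A I) {y : G}
    (hy : Disjoint (blockSet u P y) (X₀ ∪ reserve φ)) :
    RobustlyTiles d u (reserve φ) z (A ∪ I) (X₀ ∪ blockSet u P y) := by
  rw [Finset.disjoint_union_right] at hy
  obtain ⟨hy1, hy2⟩ := hy
  refine ⟨Finset.disjoint_union_left.2 ⟨hA.disjoint, hy2⟩, ?_,
    hA.addInvariant.union (addInvariant_blockSet h2 u P y), fun Z hZ => ?_⟩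
  · rw [Finset.card_union_of_disjoint hy1.symm, Finset.card_union_of_disjoint hAI, hA.card_eq,
      hI.card_blockSet hd, hI.card_eq]
    ring
  obtain ⟨X, hX, hXu, hXZ, hXsub, hXc⟩ := hA.exists_pairTiles Z hZ
  have hcardZ : (Z ∩ (X₀ ∪ blockSet u P y)).card =
      (Z ∩ X₀).card + (Z ∩ blockSet u P y).card := by
    rw [Finset.inter_union_distrib_left, Finset.card_union_of_disjoint]
    exact hy1.symm.mono Finset.inter_subset_right Finset.inter_subset_right
  rw [hcardZ]
  by_cases hdis : Disjoint (blockSet u P y) Z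
  · have hXb : Disjoint X (blockSet u P y) :=
      (Finset.disjoint_union_right.2 ⟨hy1, hy2⟩).symm.mono_left hXsub
    refine ⟨X ∪ blockSet u P y, hX.union (hI.pairTiles y) hAI hXb,
      hXu.union (addInvariant_blockSet h2 u P y), Finset.disjoint_union_left.2 ⟨hXZ, hdis⟩, ?_, ?_⟩
    · intro x hx
      rcases Finset.mem_union.1 hx with hx | hx
      · have := hXsub hx
        simp only [Finset.mem_union] at this ⊢
        tauto
      · simp [hx]
    · rw [Finset.union_inter_distrib_right, Finset.disjoint_iff_inter_eq_empty.1 hy2,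
        Finset.union_empty]
      omega
  · have hpos : 0 < (Z ∩ blockSet u P y).card := by
      rw [Finset.card_pos, Finset.inter_comm, Finset.nonempty_iff_ne_empty]
      rwa [Finset.disjoint_iff_inter_eq_empty] at hdis
    -- The set to avoid has at most `z + 8 * z` points, and eight times that is the `72 * z` of the
    -- hypothesis.
    obtain ⟨y', hy'W, hy'B⟩ := exists_blockSet_subset_reserve hφ hu P (Z ∪ (X ∩ reserve φ)) (by
      refine lt_of_le_of_lt ?_ hz
      refine Nat.mul_le_mul_right _ ?_
      have h3 := Finset.card_union_le Z (X ∩ reserve φ)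
      have h4 : (Z ∩ X₀).card ≤ Z.card := Finset.card_le_card Finset.inter_subset_left
      omega)
    rw [Finset.disjoint_union_right] at hy'B
    have hXb : Disjoint X (blockSet u P y') := by
      rw [Finset.disjoint_left]
      intro x hx hx'
      exact Finset.disjoint_left.1 hy'B.2 hx' (Finset.mem_inter.2 ⟨hx, hy'W hx'⟩)
    refine ⟨X ∪ blockSet u P y', hX.union (hI.pairTiles y') hAI hXb,
      hXu.union (addInvariant_blockSet h2 u P y'),
      Finset.disjoint_union_left.2 ⟨hXZ, hy'B.1⟩, ?_, ?_⟩
    · intro x hx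
      rcases Finset.mem_union.1 hx with hx | hx
      · have := hXsub hx
        simp only [Finset.mem_union] at this ⊢
        tauto
      · simp [hy'W hx]
    · rw [Finset.union_inter_distrib_right]
      refine (Finset.card_union_le _ _).trans ?_
      have h5 : (blockSet u P y' ∩ reserve φ).card ≤ 8 := by
        rw [← hI.card_blockSet hd y']
        exact Finset.card_le_card Finset.inter_subset_left
      omega

end Blocks

/-! ### Tiling all indices whose difference is not `u`. -/

section Main

variable {G ι : Type*} [AddCommGroup G] [DecidableEq G] [DecidableEq ι] [Fintype G]
  {K : Type*} [AddCommGroup K] [Fintype K] [DecidableEq K] {φ : G →+ (Fin 4 → K)}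

/-- A robust tiling can be enlarged by a four-block if many indices are left. -/
theorem RobustlyTiles.exists_extension (h2 : ∀ x : G, x + x = 0) (hφ : Function.Surjective φ)
    {d : ι → G} {u : G} (hu0 : u ≠ 0) (hu : φ u = 0) {z : ℕ}
    (hz : 72 * z * Fintype.card K ^ 4 < Fintype.card G) {ε : ℝ} (hε : 0 < ε)
    (hK : 8 ≤ ε * Fintype.card K) {J A : Finset ι} (hd : ∀ i ∈ J, d i ≠ 0 ∧ d i ≠ u)
    (hinj : Set.InjOn d J) (hJ : 2 * (J.card : ℝ) ≤ (1 / 2 - ε) * Fintype.card G)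
    (hAJ : A ⊆ J) {X₀ : Finset G} (hA : RobustlyTiles d u (reserve φ) z A X₀)
    (hlarge : 6 * (Fintype.card G : ℝ) < ε ^ 2 * (J \ A).card ^ 2) :
    ∃ I ⊆ J \ A, I.card = 4 ∧ ∑ i ∈ I, (d i + u) = 0 ∧
      ∃ X₁, RobustlyTiles d u (reserve φ) z (A ∪ I) X₁ := by
  set F : Finset G := (X₀ ∪ reserve φ)ᶜ with hF
  set e : ι → G := fun i => d i + u with he
  have hcancel : ∀ a b : G, a + b + b = a := fun a b => by rw [add_assoc, h2, add_zero]
  have hFinv : AddInvariant u F :=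
    (hA.addInvariant.union (addInvariant_reserve hu)).compl h2
  -- The blocks occupy at most a fraction `1 / 2 - ε` of the group and the reserve at most `ε / 2`,
  -- so the free set has density at least `(1 + ε) / 2`.
  have hFcard : (1 + ε) * Fintype.card G ≤ 2 * F.card := by
    have h3 : (Fintype.card G : ℝ) ≤ F.card + (2 * A.card + (reserve φ).card) := by
      have h4 := Finset.card_add_card_compl (X₀ ∪ reserve φ)
      have h5 := Finset.card_union_le X₀ (reserve φ)
      rw [hA.card_eq] at h5
      have h6 : Fintype.card G ≤ F.card + (2 * A.card + (reserve φ).card) := by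
        rw [hF]; omega
      exact_mod_cast h6
    have h7 : (A.card : ℝ) ≤ J.card := by exact_mod_cast Finset.card_le_card hAJ
    have h8 : ((reserve φ).card : ℝ) * Fintype.card K ≤ 4 * Fintype.card G := by
      exact_mod_cast card_reserve_mul_le hφ
    have hKpos : (0 : ℝ) < Fintype.card K := by exact_mod_cast Fintype.card_pos
    have h9 : ((reserve φ).card : ℝ) ≤ ε / 2 * Fintype.card G := by
      refine le_of_mul_le_mul_right (h8.trans ?_) hKpos
      have h10 : (0 : ℝ) ≤ Fintype.card G := Nat.cast_nonneg _
      have := mul_le_mul_of_nonneg_right hK h10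
      linarith [show ε / 2 * Fintype.card G * Fintype.card K =
        (ε * Fintype.card K * Fintype.card G) / 2 by ring]
    linarith
  have heinj : Set.InjOn e (J \ A : Finset ι) := fun i hi j hj hij =>
    hinj (Finset.sdiff_subset hi) (Finset.sdiff_subset hj) (add_right_cancel hij)
  have hScard : ((J \ A).image e).card = (J \ A).card := Finset.card_image_of_injOn heinj
  obtain ⟨x, hx, a, ha, b, hb, c, hc, g, hg, hxa, hxab, hxg, hsum, hab, habu, hbc, hbcu, hac⟩ :=
    exists_fourCycle h2 u F ((J \ A).image e) hε hFcard (by rwa [hScard])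
  obtain ⟨i₀, h₀, rfl⟩ := Finset.mem_image.1 ha
  obtain ⟨i₁, h₁, rfl⟩ := Finset.mem_image.1 hb
  obtain ⟨i₂, h₂, rfl⟩ := Finset.mem_image.1 hc
  obtain ⟨i₃, h₃, rfl⟩ := Finset.mem_image.1 hg
  have hne : ∀ i ∈ J \ A, e i ≠ 0 ∧ e i ≠ u := by
    intro i hi
    obtain ⟨h3, h4⟩ := hd i (Finset.sdiff_subset hi)
    refine ⟨fun h => h4 ?_, fun h => h3 (by simpa [he] using h)⟩
    rw [← hcancel (d i) u]
    simp only [he] at h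
    rw [h, zero_add]
  have h01 : i₀ ≠ i₁ := by rintro rfl; exact hab (h2 _)
  have h12 : i₁ ≠ i₂ := by rintro rfl; exact hbc (h2 _)
  have h02 : i₀ ≠ i₂ := by rintro rfl; exact hac (h2 _)
  have h03 : i₀ ≠ i₃ := by
    rintro rfl
    apply hbc
    rw [add_assoc (e i₀), add_comm (e i₀), hcancel] at hsum
    exact hsum
  have h13 : i₁ ≠ i₃ := by
    rintro rfl
    apply hac
    rw [add_right_comm (e i₀), hcancel] at hsum
    exact hsum
  have h23 : i₂ ≠ i₃ := by
    rintro rfl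
    apply hab
    rw [hcancel] at hsum
    exact hsum
  have hblock := isFourBlock h2 hu0 h01 h02 h03 h12 h13 h23 (d := d) rfl rfl rfl rfl hsum
    (hne _ h₀) (hne _ h₁) (hne _ h₂) (hne _ h₃) ⟨hab, habu⟩ ⟨hbc, hbcu⟩
  have hsub : ({i₀, i₁, i₂, i₃} : Finset ι) ⊆ J \ A := by
    intro i hi
    simp only [Finset.mem_insert, Finset.mem_singleton] at hi
    rcases hi with rfl | rfl | rfl | rfl <;> assumption
  refine ⟨_, hsub, hblock.card_eq, ?_, _,
    hA.union_block (y := x) h2 hφ hu hz hblock (fun i hi => (hd i (Finset.sdiff_subset (hsub hi))).1)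
      (Finset.disjoint_sdiff.mono_right hsub) ?_⟩
  · rw [Finset.sum_insert (by simp [*]), Finset.sum_insert (by simp [*]),
      Finset.sum_insert (by simp [*]), Finset.sum_singleton, ← add_assoc, ← add_assoc]
    exact hsum
  · rw [← Finset.subset_compl_iff_disjoint_right]
    refine blockSet_subset hFinv fun k => ?_
    fin_cases k
    · simpa using hx
    · exact hxa
    · exact (add_assoc x (e i₀) (e i₁)) ▸ hxab
    · exact hxg

/-- A largest robustly tiled zero-sum set `A` leaves at most `r` indices, since otherwise another
four-block could be added. The leftover has zero sum and is tiled greedily by a set `Z` of at most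
`2 * r` points, and robustness moves the tiling of `A` off `Z`. -/
theorem exists_pairTiles_of_injOn (h2 : ∀ x : G, x + x = 0) (hφ : Function.Surjective φ)
    {d : ι → G} {u : G} (hu0 : u ≠ 0) (hu : φ u = 0) {n r : ℕ} (hn : Fintype.card G = 2 ^ n)
    (hr : 4 * (n + 1) * r < 2 ^ n) (hz : 144 * r * Fintype.card K ^ 4 < 2 ^ n)
    {ε : ℝ} (hε : 0 < ε) (hK : 8 ≤ ε * Fintype.card K)
    (hlarge : 6 * (2 : ℝ) ^ n < ε ^ 2 * ((r : ℝ) + 1) ^ 2) {J : Finset ι}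
    (hd : ∀ i ∈ J, d i ≠ 0 ∧ d i ≠ u) (hinj : Set.InjOn d J)
    (hJ : 2 * (J.card : ℝ) ≤ (1 / 2 - ε) * 2 ^ n) (hsum : ∑ i ∈ J, (d i + u) = 0) :
    ∃ X, PairTiles d J X ∧ AddInvariant u X := by
  classical
  have hnR : (Fintype.card G : ℝ) = 2 ^ n := by rw [hn]; push_cast; rfl
  have hz' : 72 * (2 * r) * Fintype.card K ^ 4 < Fintype.card G := by
    rw [hn, ← mul_assoc]; exact hz
  set T : Finset (Finset ι) := {A ∈ J.powerset | ∑ i ∈ A, (d i + u) = 0 ∧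
    ∃ X₀, RobustlyTiles d u (reserve φ) (2 * r) A X₀} with hT
  have hT0 : ∅ ∈ T := by
    simp only [hT, Finset.mem_filter, Finset.mem_powerset]
    exact ⟨Finset.empty_subset _, Finset.sum_empty, ∅, RobustlyTiles.empty _ _ _ _⟩
  obtain ⟨A, hAT, hmax⟩ := Finset.exists_max_image T Finset.card ⟨_, hT0⟩
  simp only [hT, Finset.mem_filter, Finset.mem_powerset] at hAT
  obtain ⟨hAJ, hA0, X₀, hA⟩ := hAT
  have hRcard : (J \ A).card ≤ r := by
    by_contra hlt
    push Not at hlt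
    obtain ⟨I, hI, hI4, hI0, X₁, hX₁⟩ := hA.exists_extension h2 hφ hu0 hu hz' hε hK hd hinj
      (by rwa [hnR]) hAJ (by
        rw [hnR]
        refine hlarge.trans_le ?_
        have : (r : ℝ) + 1 ≤ (J \ A).card := by exact_mod_cast hlt
        gcongr)
    have hdis : Disjoint A I := Finset.disjoint_sdiff.mono_right hI
    have hmem : A ∪ I ∈ T := by
      simp only [hT, Finset.mem_filter, Finset.mem_powerset]
      refine ⟨Finset.union_subset hAJ (hI.trans Finset.sdiff_subset), ?_, X₁, hX₁⟩
      rw [Finset.sum_union hdis, hA0, hI0, add_zero]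
    have := hmax _ hmem
    rw [Finset.card_union_of_disjoint hdis] at this
    omega
  have hdR : ∀ i ∈ J \ A, d i ≠ 0 := fun i hi => (hd i (Finset.sdiff_subset hi)).1
  obtain ⟨Z, hZ, hZu⟩ := exists_pairTiles_of_small h2 hu0 hn (J \ A) hdR (by
      have := Finset.sum_sdiff (f := fun i => d i + u) hAJ
      rwa [hA0, hsum, add_zero] at this)
    (lt_of_le_of_lt (Nat.mul_le_mul_left _ hRcard) hr)
  obtain ⟨X, hX, hXu, hXZ, -⟩ := hA.exists_pairTiles Z (by rw [hZ.card_eq hdR]; omega)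
  have := hX.union hZ Finset.disjoint_sdiff hXZ
  rw [Finset.union_sdiff_of_subset hAJ] at this
  exact ⟨_, this, hXu.union hZu⟩

/-- Pairs of indices with equal differences can be inserted greedily. -/
theorem exists_pairTiles_of_forall_injOn (h2 : ∀ x : G, x + x = 0) {d : ι → G} {u : G}
    (hu0 : u ≠ 0) (k : ℕ) (hk : 4 * k ≤ Fintype.card G)
    (hinj : ∀ J : Finset ι, J.card ≤ k → (∀ i ∈ J, d i ≠ 0 ∧ d i ≠ u) → Set.InjOn d J →
      ∑ i ∈ J, (d i + u) = 0 → ∃ X, PairTiles d J X ∧ AddInvariant u X) :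
    ∀ J : Finset ι, J.card ≤ k → (∀ i ∈ J, d i ≠ 0 ∧ d i ≠ u) → ∑ i ∈ J, (d i + u) = 0 →
      ∃ X, PairTiles d J X ∧ AddInvariant u X := by
  intro J
  induction J using Finset.strongInduction with
  | H J ih =>
    intro hJk hd hsum
    by_cases hJ : Set.InjOn d J
    · exact hinj J hJk hd hJ hsum
    simp only [Set.InjOn, Finset.mem_coe] at hJ
    push Not at hJ
    obtain ⟨i, hi, j, hj, hij, hne⟩ := hJ
    have hsub : ({i, j} : Finset ι) ⊆ J := by
      intro x hx
      simp only [Finset.mem_insert, Finset.mem_singleton] at hx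
      rcases hx with rfl | rfl <;> assumption
    have hcard := Finset.card_sdiff_add_card_eq_card hsub
    rw [Finset.card_pair hne] at hcard
    have hd' : ∀ i' ∈ J \ {i, j}, d i' ≠ 0 ∧ d i' ≠ u := fun i' hi' =>
      hd i' (Finset.sdiff_subset hi')
    obtain ⟨X, hX, hXu⟩ := ih (J \ {i, j}) (Finset.sdiff_ssubset hsub ⟨i, by simp⟩) (by omega) hd'
      (by
        have := Finset.sum_sdiff (f := fun i => d i + u) hsub
        rwa [Finset.sum_pair hne, hij, h2, add_zero, hsum] at this)
    have hXcard := hX.card_eq fun i' hi' => (hd' i' hi').1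
    -- Two indices have been removed, so `2 * X.card ≤ 4 * (k - 2)`, which is strictly below the
    -- order of the group.
    obtain ⟨t, ht⟩ := exists_translate_disjoint ({0, d i} : Finset G) X (by
      have := Finset.card_le_two (a := (0 : G)) (b := d i)
      have h3 := Nat.mul_le_mul_right X.card this
      omega)
    have hXu' : ∀ x, x + u ∈ X → x ∈ X := fun x hx => by
      have := hXu _ hx
      rwa [add_assoc, h2, add_zero] at this
    have ht0 : t ∉ X := fun h => Finset.disjoint_left.1 ht
      (Finset.mem_image.2 ⟨0, by simp, by simp⟩) h
    have ht1 : t + d i ∉ X := fun h => Finset.disjoint_left.1 ht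
      (Finset.mem_image.2 ⟨d i, by simp, add_comm _ _⟩) h
    obtain ⟨hdi0, hdiu⟩ := hd i hi
    have hdu : d i + u ≠ 0 := fun h => hdiu (by
      have h3 : d i + u + u = d i := by rw [add_assoc, h2, add_zero]
      rw [← h3, h, zero_add])
    have h1 : PairTiles d {i} {t, t + d i} := ⟨fun _ => t, by simp, by simp⟩
    have h1' : PairTiles d {j} {t + u, t + u + d i} := ⟨fun _ => t + u, by simp, by simp [hij]⟩
    -- The second pair is the first one shifted by `u`, so together they are `u`-invariant.
    have hpair : PairTiles d {i, j} ({t, t + d i} ∪ {t + u, t + u + d i}) := by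
      refine h1.union h1' (by simpa using hne) ?_
      rw [Finset.disjoint_left]
      intro x hx hx'
      simp only [Finset.mem_insert, Finset.mem_singleton] at hx hx'
      rcases hx with rfl | rfl <;> rcases hx' with h | h
      · exact hu0 (by simpa using h)
      · rw [add_assoc, left_eq_add, add_comm] at h
        exact hdu h
      · exact hdiu (add_left_cancel h)
      · rw [add_right_comm] at h
        exact hu0 (by simpa using h)
    have hres := hpair.union hX Finset.disjoint_sdiff (by
      rw [Finset.disjoint_left]
      intro x hx hxX
      simp only [Finset.mem_union, Finset.mem_insert, Finset.mem_singleton] at hx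
      rcases hx with (rfl | rfl) | (rfl | rfl)
      · exact ht0 hxX
      · exact ht1 hxX
      · exact ht0 (hXu' _ hxX)
      · rw [add_right_comm] at hxX
        exact ht1 (hXu' _ hxX))
    rw [Finset.union_sdiff_of_subset hsub] at hres
    refine ⟨_, hres, AddInvariant.union ?_ hXu⟩
    intro x hx
    simp only [Finset.mem_union, Finset.mem_insert, Finset.mem_singleton] at hx ⊢
    rcases hx with (rfl | rfl) | (rfl | rfl)
    · simp
    · right; right; exact add_right_comm _ _ _
    · left; left; rw [add_assoc, h2, add_zero]
    · left; right; rw [add_right_comm, add_assoc t, h2, add_zero]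

end Main

/-! ### Choice of the homomorphism and the parameters, and conclusion. -/

/-- There is a surjection from `𝔽₂ⁿ` to four blocks of `j` coordinates that vanishes on `u`. -/
theorem exists_surjective_hom_map_eq_zero {n j : ℕ} (hnj : 4 * j + 1 ≤ n) {u : Fin n → ZMod 2}
    (hu : u ≠ 0) : ∃ φ : (Fin n → ZMod 2) →+ (Fin 4 → Fin j → ZMod 2),
      Function.Surjective φ ∧ φ u = 0 := by
  obtain ⟨c, hc⟩ := Function.ne_iff.1 hu
  have hc1 : u c = 1 := by
    rcases Fin.exists_fin_two.1 ⟨u c, rfl⟩ with h | h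
    · exact absurd h hc
    · exact h
  obtain ⟨g⟩ : Nonempty (Fin 4 × Fin j ↪ {i : Fin n // i ≠ c}) := by
    refine Function.Embedding.nonempty_of_card_le ?_
    rw [Fintype.card_prod, Fintype.card_fin, Fintype.card_fin, Fintype.card_subtype_compl,
      Fintype.card_fin, Fintype.card_subtype_eq]
    omega
  -- Adding `x c` times `u` clears coordinate `c`, because `u c = 1`, and sends `u` itself to zero.
  -- Then `4 * j` of the other coordinates are read off.
  refine ⟨{ toFun := fun x b k => x (g (b, k)) + x c * u (g (b, k))
            map_zero' := by ext; simp
            map_add' := fun x y => by ext b k; simp; ring }, fun v => ?_, ?_⟩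
  · refine ⟨Function.extend (fun p => (g p : Fin n)) (fun p => v p.1 p.2) 0, ?_⟩
    have hginj : Function.Injective (fun p => (g p : Fin n)) :=
      Subtype.val_injective.comp g.injective
    ext b k
    have h1 := hginj.extend_apply (fun p => v p.1 p.2) 0 (b, k)
    have h3 : Function.extend (fun p => (g p : Fin n)) (fun p => v p.1 p.2) 0 c = 0 :=
      Function.extend_apply' _ _ _ (by rintro ⟨p, hp⟩; exact (g p).2 hp)
    simp only [AddMonoidHom.coe_mk, ZeroHom.coe_mk]
    rw [h1, h3]
    simp
  · ext b k
    simp only [AddMonoidHom.coe_mk, ZeroHom.coe_mk, hc1, one_mul, Pi.zero_apply]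
    exact CharTwo.add_self_eq_zero _

theorem eventually_sq_mul_lt_two_pow {ε : ℝ} (hε : 0 < ε) (M : ℝ) :
    ∃ n₀ : ℕ, ∀ n ≥ n₀, 6 * M ^ 2 * ((n : ℝ) + 1) ^ 2 < ε ^ 2 * 2 ^ n := by
  have h1 : Filter.Tendsto (fun n : ℕ => ((n : ℝ)) ^ 2 / 2 ^ n) Filter.atTop (nhds 0) :=
    tendsto_pow_const_div_const_pow_of_one_lt 2 (by norm_num)
  have h2 := (Filter.tendsto_add_atTop_iff_nat 1).2 h1
  have hpos : 0 < ε ^ 2 / (12 * M ^ 2 + 1) := by positivity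
  obtain ⟨n₀, hn₀⟩ := Filter.eventually_atTop.1 (h2.eventually (gt_mem_nhds hpos))
  refine ⟨n₀, fun n hn => ?_⟩
  have h3 := hn₀ n hn
  rw [div_lt_div_iff₀ (by positivity) (by positivity)] at h3
  push_cast at h3
  rw [pow_succ (2 : ℝ) n] at h3
  have : (0 : ℝ) < ((n : ℝ) + 1) ^ 2 := by positivity
  linarith [show ((n : ℝ) + 1) ^ 2 * (12 * M ^ 2 + 1) =
    2 * (6 * M ^ 2 * ((n : ℝ) + 1) ^ 2) + ((n : ℝ) + 1) ^ 2 by ring]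

theorem PairTiles.isDifferencePairing {G ι : Type*} [AddCommGroup G] [DecidableEq G] [Fintype G]
    [Fintype ι] (h2 : ∀ x : G, x + x = 0) {d : ι → G} (hd : ∀ i, d i ≠ 0)
    (h : PairTiles d Finset.univ Finset.univ) : ∃ a b : ι → G, IsDifferencePairing d a b := by
  obtain ⟨a, ha, hcov⟩ := h
  refine ⟨a, fun i => a i + d i, fun i => by simpa using hd i, fun i => ?_, fun i j hij => ?_, ?_⟩
  · have := h2 (d i)
    rw [sub_add_cancel_left]
    exact neg_eq_of_add_eq_zero_left this
  · have := ha i (Finset.mem_univ _) j (Finset.mem_univ _) hij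
    rw [← Finset.disjoint_coe] at this
    simpa using this
  · have := congrArg (fun s : Finset G => (s : Set G)) hcov
    simpa using this

theorem mainTheorem2 :
    ∀ ε : ℝ, 0 < ε → ∃ n₀ : ℕ, ∀ n : ℕ, n₀ ≤ n → 2 ≤ n →
      ∀ d : Fin (2 ^ (n - 1)) → (Fin n → ZMod 2),
        (∀ i, d i ≠ 0) → ∑ i, d i = 0 →
        (∃ u : Fin n → ZMod 2,
          (1 / 2 + ε) * (2 : ℝ) ^ (n - 1) ≤ ((Finset.univ.filter fun i => d i = u).card : ℝ)) →
        ∃ a b : Fin (2 ^ (n - 1)) → (Fin n → ZMod 2), IsDifferencePairing d a b := by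
  intro ε hε
  -- With `2 ^ j > 8 / ε` the reserve has density at most `4 / 2 ^ j < ε / 2`.
  obtain ⟨j, hj⟩ := pow_unbounded_of_one_lt (8 / ε) (by norm_num : (1 : ℝ) < 2)
  set M : ℕ := 145 * (2 ^ j) ^ 4 with hM
  have hM5 : 145 ≤ M := Nat.le_mul_of_pos_right _ (by positivity)
  obtain ⟨n₁, hn₁⟩ := eventually_sq_mul_lt_two_pow hε (M : ℝ)
  refine ⟨max n₁ (4 * j + 1), fun n hn hn2 d hd hsum ⟨u, hu⟩ => ?_⟩
  have hnn₁ := hn₁ n ((le_max_left _ _).trans hn)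
  have hnj : 4 * j + 1 ≤ n := (le_max_right _ _).trans hn
  have h2 : ∀ x : Fin n → ZMod 2, x + x = 0 := fun x => by
    ext i; exact CharTwo.add_self_eq_zero _
  have hpow : 2 ^ n = 2 * 2 ^ (n - 1) := by
    rw [← pow_succ']; congr 1; omega
  have hpowR : (2 : ℝ) ^ n = 2 * 2 ^ (n - 1) := by exact_mod_cast hpow
  have hcardG : Fintype.card (Fin n → ZMod 2) = 2 ^ n := by simp
  set J : Finset (Fin (2 ^ (n - 1))) := {i | d i ≠ u} with hJ
  have hJcard : ((Finset.univ.filter fun i => d i = u).card) + J.card = 2 ^ (n - 1) := by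
    rw [hJ, Finset.card_filter_add_card_filter_not]; simp
  have hJcardR : ((Finset.univ.filter fun i => d i = u).card : ℝ) + J.card = 2 ^ (n - 1) := by
    exact_mod_cast hJcard
  have hu0 : u ≠ 0 := by
    have : (0 : ℝ) < ((Finset.univ.filter fun i => d i = u).card : ℝ) :=
      lt_of_lt_of_le (by positivity) hu
    obtain ⟨i, hi⟩ := Finset.card_pos.1 (Nat.cast_pos.1 this)
    rw [← (Finset.mem_filter.1 hi).2]
    exact hd i
  obtain ⟨φ, hφ, hφu⟩ := exists_surjective_hom_map_eq_zero hnj hu0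
  have hcardK : Fintype.card (Fin j → ZMod 2) = 2 ^ j := by simp
  -- The leftover size `r` is of order `2 ^ n / n`: small enough for the greedy tiling and for the
  -- reserve (`145` just exceeds the required `144`), yet far above the order `2 ^ (n / 2)` from
  -- which four-cycles exist.
  set r : ℕ := 2 ^ n / (M * (n + 1)) with hr
  have hrle : r * (M * (n + 1)) ≤ 2 ^ n := Nat.div_mul_le_self _ _
  have hrlt : 2 ^ n < (r + 1) * (M * (n + 1)) := by
    rw [mul_comm]; exact Nat.lt_mul_div_succ _ (by positivity)
  have hr1 : 4 * (n + 1) * r < 2 ^ n := by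
    rcases Nat.eq_zero_or_pos r with h | h
    · rw [h, mul_zero]; positivity
    · refine lt_of_lt_of_le ?_ hrle
      calc 4 * (n + 1) * r = r * (4 * (n + 1)) := by ring
        _ < r * (M * (n + 1)) := by gcongr; omega
  have hr2 : 144 * r * Fintype.card (Fin j → ZMod 2) ^ 4 < 2 ^ n := by
    rw [hcardK]
    rcases Nat.eq_zero_or_pos r with h | h
    · rw [h, mul_zero, zero_mul]; positivity
    · refine lt_of_lt_of_le ?_ hrle
      calc 144 * r * (2 ^ j) ^ 4 < 145 * r * (2 ^ j) ^ 4 := by gcongr; norm_num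
        _ = r * (M * 1) := by rw [hM]; ring
        _ ≤ r * (M * (n + 1)) := by gcongr; omega
  have hr3 : 6 * (2 : ℝ) ^ n < ε ^ 2 * ((r : ℝ) + 1) ^ 2 := by
    have h3 : (2 : ℝ) ^ n < ((r : ℝ) + 1) * (M * (n + 1)) := by exact_mod_cast hrlt
    have hMpos : (0 : ℝ) < (M * (n + 1)) ^ 2 := by positivity
    have h4 : ((2 : ℝ) ^ n) ^ 2 ≤ (((r : ℝ) + 1) * (M * (n + 1))) ^ 2 :=
      pow_le_pow_left₀ (by positivity) h3.le 2
    refine lt_of_mul_lt_mul_right ?_ hMpos.le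
    calc 6 * (2 : ℝ) ^ n * (M * (n + 1)) ^ 2 = 6 * M ^ 2 * ((n : ℝ) + 1) ^ 2 * 2 ^ n := by ring
      _ < ε ^ 2 * 2 ^ n * 2 ^ n := mul_lt_mul_of_pos_right hnn₁ (by positivity)
      _ = ε ^ 2 * (2 ^ n) ^ 2 := by ring
      _ ≤ ε ^ 2 * (((r : ℝ) + 1) * (M * (n + 1))) ^ 2 :=
        mul_le_mul_of_nonneg_left h4 (by positivity)
      _ = ε ^ 2 * ((r : ℝ) + 1) ^ 2 * (M * (n + 1)) ^ 2 := by ring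
  have hK : 8 ≤ ε * (Fintype.card (Fin j → ZMod 2) : ℝ) := by
    rw [hcardK]
    push_cast
    rw [div_lt_iff₀ hε] at hj
    linarith
  have hJle : 2 * (J.card : ℝ) ≤ (1 / 2 - ε) * 2 ^ n := by
    rw [hpowR]; linarith
  have hJsum : ∑ i ∈ J, (d i + u) = 0 := by
    -- The number `2 ^ (n - 1)` of indices is even because `n ≥ 2`, so the copies of `u` cancel.
    have h3 : ∑ i, (d i + u) = 0 := by
      rw [Finset.sum_add_distrib, hsum, zero_add, Finset.sum_const, Finset.card_univ,
        Fintype.card_fin, show 2 ^ (n - 1) = 2 ^ (n - 2) * 2 by rw [← pow_succ]; congr 1; omega,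
        mul_nsmul', two_nsmul, h2, nsmul_zero]
    rw [← h3]
    refine Finset.sum_subset (Finset.subset_univ _) fun i _ hi => ?_
    have : d i = u := by simpa [hJ] using hi
    rw [this, h2]
  obtain ⟨X, hX, hXu⟩ := exists_pairTiles_of_forall_injOn h2 hu0 J.card (by
      rw [hcardG]
      have h3 : (4 : ℝ) * J.card ≤ 2 ^ n := by
        have : (0 : ℝ) ≤ ε * 2 ^ n := by positivity
        linarith
      exact_mod_cast h3)
    (fun J' hJ'c hd' hinj hs => exists_pairTiles_of_injOn h2 hφ hu0 hφu hcardG hr1 hr2 hε hK hr3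
      hd' hinj (le_trans (by gcongr) hJle) hs)
    J le_rfl (fun i hi => ⟨hd i, by simpa [hJ] using hi⟩) hJsum
  have hY := pairTiles_of_forall_eq (d := d) h2 hu0 Jᶜ Xᶜ (fun i hi => by simpa [hJ] using hi)
    (hXu.compl h2) (by
      rw [Finset.card_compl, Finset.card_compl, hX.card_eq fun i _ => hd i, hcardG,
        Fintype.card_fin]
      omega)
  have hall := hX.union hY disjoint_compl_right disjoint_compl_right
  rw [Finset.union_compl, Finset.union_compl] at hall
  exact hall.isDifferencePairing h2 hd
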